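/- A topological groupoid $\mathcal G$ with unit space $\mathcal G^0$, range map $r$ and source map $s$ is \emph{ample} if $\mathcal G^0$ is locally compact, Hausdorff and totally disconnected and $s\colon\mathcal G\to\mathcal G^0$ is a local homeomorphism; it is \emph{principal} if its isotropy groups are all trivial, and \emph{compact} means quasi-compact and Hausdorff. For a space $X$ with a basis of compact open sets, $\mathbb ZX$ denotes the group of functions $X\to\mathbb Z$ generated by the characteristic functions of the compact open subsets of $X$. The group $\mathbb Z\mathcal G$ is a ring under convolution $(f*h)(g)=\sum_{r(a)=r(g)}f(a)h(a^{-1}g)$, the group $\mathbb Z\mathcal G^0$ is a right $\mathbb Z\mathcal G$-module via $(hf)(x)=\sum_{s(g)=x}h(r(g))f(g)$, and for a unitary left $\mathbb Z\mathcal G$-module $M$ one puts $H_n(\mathcal G,M)=\mathrm{Tor}_n^{\mathbb Z\mathcal G}(\mathbb Z\mathcal G^0,M)$. The homological dimension of $\mathcal G$ is $\sup\{n\ge 0\mid H_n(\mathcal G,M)\neq 0\text{ for some unitary left }\mathbb Z\mathcal G\text{-module }M\}$ (with $\sup\emptyset=0$). Theorem. Let $\mathcal G$ be a compact principal ample groupoid.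 Then $\mathcal G$ has homological dimension $0$; that is, $H_n(\mathcal G,M)=0$ for all $n\ge 1$ and all unitary left $\mathbb Z\mathcal G$-modules $M$. Moreover, the orbit space of $\mathcal G$ (the quotient of $\mathcal G^0$ by the relation of being joined by an arrow) is compact Hausdorff and totally disconnected, and the quotient map from $\mathcal G^0$ to the orbit space has a continuous section $t$ whose image $Y$ is a compact open subset of $\mathcal G^0$ that meets every orbit and satisfies $\{g\in\mathcal G\mid r(g)\in Y,\ s(g)\in Y\}=Y$ (units being identified with identity arrows). -/

import Mathlib

open CategoryTheory Topology

universe u w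

/-- A topological groupoid, given by its space `Unit` of units and its space `Arrow` of arrows.
The product `mul g h` is defined when the source of `g` is the range of `h`. -/
structure TopGroupoid where
  Unit : Type u
  Arrow : Type u
  [topUnit : TopologicalSpace Unit]
  [topArrow : TopologicalSpace Arrow]
  r : Arrow → Unit
  s : Arrow → Unit
  unit : Unit → Arrow
  inv : Arrow → Arrow
  mul : ∀ g h : Arrow, s g = r h → Arrow
  r_unit : ∀ x, r (unit x) = x
  s_unit : ∀ x, s (unit x) = x
  r_inv : ∀ g, r (inv g) = s g
  s_inv : ∀ g, s (inv g) = r g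
  r_mul : ∀ g h e, r (mul g h e) = r g
  s_mul : ∀ g h e, s (mul g h e) = s h
  unit_mul : ∀ g, mul (unit (r g)) g (s_unit _) = g
  mul_unit : ∀ g, mul g (unit (s g)) (r_unit _).symm = g
  inv_mul : ∀ g, mul (inv g) g (s_inv g) = unit (s g)
  mul_inv : ∀ g, mul g (inv g) (r_inv g).symm = unit (r g)
  mul_assoc : ∀ g h k (e₁ : s g = r h) (e₂ : s h = r k),
    mul (mul g h e₁) k ((s_mul _ _ _).trans e₂) = mul g (mul h k e₂) (e₁.trans (r_mul _ _ _).symm)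
  continuous_r : Continuous r
  continuous_s : Continuous s
  continuous_unit : Continuous unit
  continuous_inv : Continuous inv
  continuous_mul : Continuous fun p : {p : Arrow × Arrow // s p.1 = r p.2} =>
    mul p.1.1 p.1.2 p.2

attribute [instance] TopGroupoid.topUnit TopGroupoid.topArrow

/-- The group `ℤX` of functions `X → ℤ` generated by the characteristic functions of the compact
(that is, quasi-compact and Hausdorff) open subsets of `X`. -/
def zFun (X : Type u) [TopologicalSpace X] : AddSubgroup (X → ℤ) :=
  AddSubgroup.closure
    {f | ∃ U : Set X, IsOpen U ∧ IsCompact U ∧ T2Space U ∧ f = U.indicator 1}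

namespace TopGroupoid

variable (𝒢 : TopGroupoid.{u})

/-- Ample groupoids: the unit space is locally compact, Hausdorff and totally disconnected, and
the source map is a local homeomorphism. The space of arrows need not be Hausdorff. -/
class IsAmple : Prop where
  locallyCompact : LocallyCompactSpace 𝒢.Unit
  t2 : T2Space 𝒢.Unit
  totallyDisconnected : TotallyDisconnectedSpace 𝒢.Unit
  isLocalHomeomorph_s : IsLocalHomeomorph 𝒢.s

attribute [instance] IsAmple.locallyCompact IsAmple.t2 IsAmple.totallyDisconnected

/-- Principal groupoids: every isotropy group is trivial. -/
def IsPrincipal : Prop := ∀ g : 𝒢.Arrow, 𝒢.s g = 𝒢.r g → g = 𝒢.unit (𝒢.s g)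

/-- The orbit equivalence relation on the unit space. -/
def orbitSetoid : Setoid 𝒢.Unit where
  r x y := ∃ g : 𝒢.Arrow, 𝒢.s g = x ∧ 𝒢.r g = y
  iseqv :=
    { refl := fun x => ⟨𝒢.unit x, 𝒢.s_unit x, 𝒢.r_unit x⟩
      symm := fun ⟨g, h₁, h₂⟩ => ⟨𝒢.inv g, (𝒢.s_inv g).trans h₂, (𝒢.r_inv g).trans h₁⟩
      trans := fun ⟨g, h₁, h₂⟩ ⟨k, h₃, h₄⟩ =>
        ⟨𝒢.mul k g (h₃.trans h₂.symm), (𝒢.s_mul _ _ _).trans h₁, (𝒢.r_mul _ _ _).trans h₄⟩ }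

/-- The orbit space, with the quotient topology. -/
abbrev OrbitSpace : Type u := Quotient 𝒢.orbitSetoid

/-- The quotient map from the unit space to the orbit space. -/
def orbitMap (x : 𝒢.Unit) : 𝒢.OrbitSpace := Quotient.mk 𝒢.orbitSetoid x

/-- A set of units is full if it meets every orbit. -/
def IsFull (Y : Set 𝒢.Unit) : Prop := 𝒢.r '' (𝒢.s ⁻¹' Y) = Set.univ

/-- The convolution product `(f * h)(g) = ∑ f(a) h(a⁻¹g)`, the sum over all arrows `a` with
`r(a) = r(g)`. For `f ∈ ℤ𝒢` only finitely many terms are nonzero. -/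
noncomputable def conv (f h : 𝒢.Arrow → ℤ) (g : 𝒢.Arrow) : ℤ :=
  ∑ᶠ a : {a : 𝒢.Arrow // 𝒢.r a = 𝒢.r g}, f a * h (𝒢.mul (𝒢.inv a) g ((𝒢.s_inv a).trans a.2))

/-- The action `(hf)(x) = ∑ h(r(g)) f(g)`, the sum over all arrows `g` with `s(g) = x`.
For `f ∈ ℤ𝒢` only finitely many terms are nonzero. -/
noncomputable def act (h : 𝒢.Unit → ℤ) (f : 𝒢.Arrow → ℤ) (x : 𝒢.Unit) : ℤ :=
  ∑ᶠ g : {g : 𝒢.Arrow // 𝒢.s g = x}, h (𝒢.r g) * f g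

variable {𝒢}

/-! Auxiliary facts, needed only to see that convolution makes `ℤ𝒢` a ring and that the action
makes `ℤ𝒢⁰` a right module over it. -/

section Aux

theorem mul_congr {a a' b b' : 𝒢.Arrow} (ha : a = a') (hb : b = b') (e : 𝒢.s a = 𝒢.r b)
    (e' : 𝒢.s a' = 𝒢.r b') : 𝒢.mul a b e = 𝒢.mul a' b' e' := by
  subst ha; subst hb; rfl

theorem inv_mul_cancel_left (v x : 𝒢.Arrow) (e : 𝒢.s v = 𝒢.r x)
    (e' : 𝒢.s (𝒢.inv v) = 𝒢.r (𝒢.mul v x e)) : 𝒢.mul (𝒢.inv v) (𝒢.mul v x e) e' = x := by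
  rw [← 𝒢.mul_assoc _ _ _ (𝒢.s_inv v) e]
  refine Eq.trans (mul_congr ((𝒢.inv_mul v).trans (congrArg _ e)) rfl _ (𝒢.s_unit _)) ?_
  exact 𝒢.unit_mul x

theorem mul_inv_cancel_left (v x : 𝒢.Arrow) (e : 𝒢.s (𝒢.inv v) = 𝒢.r x)
    (e' : 𝒢.s v = 𝒢.r (𝒢.mul (𝒢.inv v) x e)) : 𝒢.mul v (𝒢.mul (𝒢.inv v) x e) e' = x := by
  rw [← 𝒢.mul_assoc _ _ _ (𝒢.r_inv v).symm e]
  refine Eq.trans (mul_congr ((𝒢.mul_inv v).trans (congrArg _ ?_)) rfl _ (𝒢.s_unit _)) ?_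
  · rw [← e, 𝒢.s_inv]
  exact 𝒢.unit_mul x

theorem inv_inv (g : 𝒢.Arrow) : 𝒢.inv (𝒢.inv g) = g := by
  have h := inv_mul_cancel_left (𝒢.inv g) g (𝒢.s_inv g)
    (by rw [𝒢.s_inv, 𝒢.r_mul])
  refine Eq.trans ?_ h
  refine Eq.trans (𝒢.mul_unit _).symm (mul_congr rfl ?_ _ _)
  rw [𝒢.inv_mul, 𝒢.s_inv, 𝒢.r_inv]

/-- Compact open bisections. -/
structure IsCOB (V : Set 𝒢.Arrow) : Prop where
  isOpen : IsOpen V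
  isCompact : IsCompact V
  inj_s : Set.InjOn 𝒢.s V
  inj_r : Set.InjOn 𝒢.r V

theorem isLocalHomeomorph_r [𝒢.IsAmple] : IsLocalHomeomorph 𝒢.r := by
  have h : 𝒢.r = 𝒢.s ∘ 𝒢.inv := by
    funext g; exact (𝒢.s_inv g).symm
  rw [h]
  let e : 𝒢.Arrow ≃ₜ 𝒢.Arrow :=
    { toFun := 𝒢.inv
      invFun := 𝒢.inv
      left_inv := inv_inv
      right_inv := inv_inv
      continuous_toFun := 𝒢.continuous_inv
      continuous_invFun := 𝒢.continuous_inv }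
  exact IsAmple.isLocalHomeomorph_s.comp e.isLocalHomeomorph

theorem exists_compact_open {X : Type u} [TopologicalSpace X] [LocallyCompactSpace X] [T2Space X]
    [TotallyDisconnectedSpace X] {O : Set X} (hO : IsOpen O) {x : X} (hx : x ∈ O) :
    ∃ C, IsOpen C ∧ IsCompact C ∧ x ∈ C ∧ C ⊆ O := by
  obtain ⟨K, hK, hxK, hKO⟩ := exists_compact_subset hO hx
  obtain ⟨C, hC, hxC, hCK⟩ :=
    (loc_compact_Haus_tot_disc_of_zero_dim (H := X)).exists_subset_of_mem_open hxK isOpen_interior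
  exact ⟨C, hC.isOpen, hK.of_isClosed_subset hC.isClosed (hCK.trans interior_subset), hxC,
    hCK.trans (interior_subset.trans hKO)⟩

theorem exists_cob [𝒢.IsAmple] {U : Set 𝒢.Arrow} (hU : IsOpen U) {g : 𝒢.Arrow} (hg : g ∈ U) :
    ∃ V, IsCOB V ∧ g ∈ V ∧ V ⊆ U := by
  obtain ⟨e, he, hes⟩ := (IsAmple.isLocalHomeomorph_s (𝒢 := 𝒢)) g
  obtain ⟨e', he', her⟩ := (isLocalHomeomorph_r (𝒢 := 𝒢)) g
  set W := U ∩ (e.source ∩ e'.source)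
  have hW : IsOpen W := hU.inter (e.open_source.inter e'.open_source)
  have hsW : IsOpen (𝒢.s '' W) := (IsAmple.isLocalHomeomorph_s (𝒢 := 𝒢)).isOpenMap _ hW
  obtain ⟨C, hC, hCc, hgC, hCW⟩ := exists_compact_open hsW ⟨g, ⟨hg, he, he'⟩, rfl⟩
  have hWe : ∀ a ∈ W, e.symm (𝒢.s a) = a := by
    intro a ha; rw [hes]; exact e.left_inv ha.2.1
  have himg : W ∩ 𝒢.s ⁻¹' C = e.symm '' C := by
    ext a; constructor
    · rintro ⟨ha, hb⟩; exact ⟨_, hb, hWe a ha⟩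
    · rintro ⟨c, hc, rfl⟩
      obtain ⟨a, ha, rfl⟩ := hCW hc
      rw [hWe a ha]; exact ⟨ha, hc⟩
  have hCt : C ⊆ e.target := by
    intro c hc
    obtain ⟨a, ha, rfl⟩ := hCW hc
    rw [hes]; exact e.map_source ha.2.1
  refine ⟨W ∩ 𝒢.s ⁻¹' C, ⟨hW.inter (hC.preimage 𝒢.continuous_s), ?_, ?_, ?_⟩,
    ⟨⟨hg, he, he'⟩, hgC⟩, fun a ha => ha.1.1⟩
  · rw [himg]; exact hCc.image_of_continuousOn (e.continuousOn_symm.mono hCt)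
  · rw [hes]; exact e.injOn.mono fun a ha => ha.1.2.1
  · rw [her]; exact e'.injOn.mono fun a ha => ha.1.2.2

theorem IsCOB.t2 [𝒢.IsAmple] {V : Set 𝒢.Arrow} (hV : IsCOB V) : T2Space V :=
  T2Space.of_injective_continuous (f := fun a : V => 𝒢.s a)
    (fun a b h => Subtype.ext (hV.inj_s a.2 b.2 h)) (𝒢.continuous_s.comp continuous_subtype_val)

theorem IsCOB.mem_zFun [𝒢.IsAmple] {V : Set 𝒢.Arrow} (hV : IsCOB V) :
    V.indicator (1 : 𝒢.Arrow → ℤ) ∈ zFun 𝒢.Arrow :=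
  AddSubgroup.subset_closure ⟨V, hV.isOpen, hV.isCompact, hV.t2, rfl⟩

theorem IsCOB.subset {V W : Set 𝒢.Arrow} (hV : IsCOB V) (hW : IsOpen W) (hWc : IsCompact W)
    (h : W ⊆ V) : IsCOB W :=
  ⟨hW, hWc, hV.inj_s.mono h, hV.inj_r.mono h⟩

theorem compact_open_diff {X : Type u} [TopologicalSpace X] {U V W : Set X} [T2Space U]
    (hVU : V ⊆ U) (hWU : W ⊆ U) (hU : IsOpen U)
    (hV : IsOpen V) (hVc : IsCompact V) (hW : IsOpen W) (hWc : IsCompact W) :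
    IsOpen (V \ W) ∧ IsCompact (V \ W) := by
  have key : ∀ A : Set X, A ⊆ U → IsCompact A → IsCompact ((↑) ⁻¹' A : Set U) := by
    intro A hA hAc
    rw [Subtype.isCompact_iff, Set.image_preimage_eq_of_subset (by simpa using hA)]
    exact hAc
  constructor
  · have h1 : IsOpen ((↑) ⁻¹' (V \ W) : Set U) := by
      rw [Set.preimage_sdiff]
      exact (hV.preimage continuous_subtype_val).sdiff (key W hWU hWc).isClosed
    have h2 := hU.isOpenMap_subtype_val _ h1
    rwa [Set.image_preimage_eq_of_subset (by simpa using Set.sdiff_subset.trans hVU)] at h2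
  · exact hVc.diff hW

theorem mem_zFun_induction [𝒢.IsAmple] {P : (𝒢.Arrow → ℤ) → Prop}
    (ind : ∀ V : Set 𝒢.Arrow, IsCOB V → P (V.indicator 1)) (zero : P 0)
    (add : ∀ f ∈ zFun 𝒢.Arrow, ∀ h ∈ zFun 𝒢.Arrow, P f → P h → P (f + h))
    (neg : ∀ f ∈ zFun 𝒢.Arrow, P f → P (-f)) {f : 𝒢.Arrow → ℤ} (hf : f ∈ zFun 𝒢.Arrow) : P f := by
  classical
  refine AddSubgroup.closure_induction ?_ zero (fun f h hf hh => add f hf h hh)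
    (fun f hf => neg f hf) hf
  rintro _ ⟨U, hU, hUc, hU2, rfl⟩
  -- all finite unions of compact open bisections inside `U`
  have main : ∀ t : Finset (Set 𝒢.Arrow), (∀ V ∈ t, IsCOB V ∧ V ⊆ U) →
      IsOpen (⋃ V ∈ t, V) ∧ IsCompact (⋃ V ∈ t, V) ∧ (⋃ V ∈ t, V) ⊆ U ∧
        (⋃ V ∈ t, V).indicator (1 : 𝒢.Arrow → ℤ) ∈ zFun 𝒢.Arrow ∧
        P ((⋃ V ∈ t, V).indicator 1) := by
    intro t
    induction t using Finset.induction_on with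
    | empty =>
      intro _
      simpa using ⟨(zFun 𝒢.Arrow).zero_mem, zero⟩
    | insert V t _ ih =>
      intro ht
      obtain ⟨h1, h2, h3, h4, h5⟩ := ih fun V hV => ht V (Finset.mem_insert_of_mem hV)
      obtain ⟨hV, hVU⟩ := ht V (Finset.mem_insert_self _ _)
      set A := ⋃ V ∈ t, V
      have hA : (⋃ B ∈ insert V t, B) = A ∪ (V \ A) := by
        rw [Finset.set_biUnion_insert, Set.union_sdiff_self, Set.union_comm]
      obtain ⟨d1, d2⟩ := compact_open_diff hVU h3 hU hV.isOpen hV.isCompact h1 h2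
      have hd : IsCOB (V \ A) := hV.subset d1 d2 Set.sdiff_subset
      have hi : (A ∪ (V \ A)).indicator (1 : 𝒢.Arrow → ℤ)
          = A.indicator 1 + (V \ A).indicator 1 :=
        Set.indicator_union_of_disjoint Set.disjoint_sdiff_right 1
      rw [hA, hi]
      exact ⟨h1.union d1, h2.union d2, Set.union_subset h3 (Set.sdiff_subset.trans hVU),
        (zFun _).add_mem h4 hd.mem_zFun, add _ h4 _ hd.mem_zFun h5 (ind _ hd)⟩
  choose! B hB hgB hBU using fun g (hg : g ∈ U) => exists_cob hU hg
  obtain ⟨t, ht, hUt⟩ := hUc.elim_nhds_subcover B fun g hg => (hB g hg).isOpen.mem_nhds (hgB g hg)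
  have h := main (t.image B) (by
    intro V hV
    obtain ⟨g, hg, rfl⟩ := Finset.mem_image.1 hV
    exact ⟨hB g (ht g hg), hBU g (ht g hg)⟩)
  rw [Finset.set_biUnion_finset_image] at h
  rw [show U = ⋃ x ∈ t, B x from hUt.antisymm h.2.2.1]
  exact h.2.2.2.2

theorem finite_r [𝒢.IsAmple] {f : 𝒢.Arrow → ℤ} (hf : f ∈ zFun 𝒢.Arrow) (x : 𝒢.Unit) :
    {a | 𝒢.r a = x ∧ f a ≠ 0}.Finite := by
  refine mem_zFun_induction (P := fun f => {a | 𝒢.r a = x ∧ f a ≠ 0}.Finite) ?_ ?_ ?_ ?_ hf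
  · intro V hV
    refine Set.Subsingleton.finite ?_
    rintro a ⟨ha, ha'⟩ b ⟨hb, hb'⟩
    exact hV.inj_r (Set.mem_of_indicator_ne_zero ha') (Set.mem_of_indicator_ne_zero hb')
      (ha.trans hb.symm)
  · simp
  · intro f _ h _ h1 h2
    refine (h1.union h2).subset ?_
    rintro a ⟨ha, ha'⟩
    by_cases hfa : f a = 0
    · exact Or.inr ⟨ha, fun h0 => ha' (by simp [hfa, h0])⟩
    · exact Or.inl ⟨ha, hfa⟩
  · intro f _ h1
    simpa using h1

theorem finite_s [𝒢.IsAmple] {f : 𝒢.Arrow → ℤ} (hf : f ∈ zFun 𝒢.Arrow) (x : 𝒢.Unit) :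
    {a | 𝒢.s a = x ∧ f a ≠ 0}.Finite := by
  refine mem_zFun_induction (P := fun f => {a | 𝒢.s a = x ∧ f a ≠ 0}.Finite) ?_ ?_ ?_ ?_ hf
  · intro V hV
    refine Set.Subsingleton.finite ?_
    rintro a ⟨ha, ha'⟩ b ⟨hb, hb'⟩
    exact hV.inj_s (Set.mem_of_indicator_ne_zero ha') (Set.mem_of_indicator_ne_zero hb')
      (ha.trans hb.symm)
  · simp
  · intro f _ h _ h1 h2
    refine (h1.union h2).subset ?_
    rintro a ⟨ha, ha'⟩
    by_cases hfa : f a = 0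
    · exact Or.inr ⟨ha, fun h0 => ha' (by simp [hfa, h0])⟩
    · exact Or.inl ⟨ha, hfa⟩
  · intro f _ h1
    simpa using h1

theorem conv_finite [𝒢.IsAmple] {f : 𝒢.Arrow → ℤ} (hf : f ∈ zFun 𝒢.Arrow) (h : 𝒢.Arrow → ℤ)
    (g : 𝒢.Arrow) : (Function.support fun a : {a : 𝒢.Arrow // 𝒢.r a = 𝒢.r g} =>
      f a * h (𝒢.mul (𝒢.inv a) g ((𝒢.s_inv a).trans a.2))).Finite := by
  refine ((finite_r hf (𝒢.r g)).preimage Subtype.val_injective.injOn).subset ?_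
  intro a ha
  exact ⟨a.2, left_ne_zero_of_mul ha⟩

theorem act_finite [𝒢.IsAmple] {f : 𝒢.Arrow → ℤ} (hf : f ∈ zFun 𝒢.Arrow) (h : 𝒢.Unit → ℤ)
    (x : 𝒢.Unit) : (Function.support fun g : {g : 𝒢.Arrow // 𝒢.s g = x} =>
      h (𝒢.r g) * f g).Finite := by
  refine ((finite_s hf x).preimage Subtype.val_injective.injOn).subset ?_
  intro a ha
  exact ⟨a.2, right_ne_zero_of_mul ha⟩

theorem conv_add_left [𝒢.IsAmple] {f f' : 𝒢.Arrow → ℤ} (hf : f ∈ zFun 𝒢.Arrow)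
    (hf' : f' ∈ zFun 𝒢.Arrow) (h : 𝒢.Arrow → ℤ) :
    𝒢.conv (f + f') h = 𝒢.conv f h + 𝒢.conv f' h := by
  funext g
  simp only [conv, Pi.add_apply, add_mul]
  exact finsum_add_distrib (conv_finite hf h g) (conv_finite hf' h g)

theorem conv_add_right [𝒢.IsAmple] {f : 𝒢.Arrow → ℤ} (hf : f ∈ zFun 𝒢.Arrow)
    (h h' : 𝒢.Arrow → ℤ) : 𝒢.conv f (h + h') = 𝒢.conv f h + 𝒢.conv f h' := by
  funext g
  simp only [conv, Pi.add_apply, mul_add]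
  exact finsum_add_distrib (conv_finite hf h g) (conv_finite hf h' g)

theorem conv_neg_left (f h : 𝒢.Arrow → ℤ) : 𝒢.conv (-f) h = -𝒢.conv f h := by
  funext g
  simp only [conv, Pi.neg_apply, neg_mul, finsum_neg_distrib]

theorem conv_neg_right (f h : 𝒢.Arrow → ℤ) : 𝒢.conv f (-h) = -𝒢.conv f h := by
  funext g
  simp only [conv, Pi.neg_apply, mul_neg, finsum_neg_distrib]

theorem conv_zero_left (h : 𝒢.Arrow → ℤ) : 𝒢.conv 0 h = 0 := by
  funext g; simp [conv]

theorem conv_zero_right (f : 𝒢.Arrow → ℤ) : 𝒢.conv f 0 = 0 := by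
  funext g; simp [conv]

theorem act_add_left [𝒢.IsAmple] {f : 𝒢.Arrow → ℤ} (hf : f ∈ zFun 𝒢.Arrow)
    (h h' : 𝒢.Unit → ℤ) : 𝒢.act (h + h') f = 𝒢.act h f + 𝒢.act h' f := by
  funext g
  simp only [act, Pi.add_apply, add_mul]
  exact finsum_add_distrib (act_finite hf h g) (act_finite hf h' g)

theorem act_add_right [𝒢.IsAmple] {f f' : 𝒢.Arrow → ℤ} (hf : f ∈ zFun 𝒢.Arrow)
    (hf' : f' ∈ zFun 𝒢.Arrow) (h : 𝒢.Unit → ℤ) :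
    𝒢.act h (f + f') = 𝒢.act h f + 𝒢.act h f' := by
  funext g
  simp only [act, Pi.add_apply, mul_add]
  exact finsum_add_distrib (act_finite hf h g) (act_finite hf' h g)

theorem act_neg_left (h : 𝒢.Unit → ℤ) (f : 𝒢.Arrow → ℤ) : 𝒢.act (-h) f = -𝒢.act h f := by
  funext g
  simp only [act, Pi.neg_apply, neg_mul, finsum_neg_distrib]

theorem act_neg_right (h : 𝒢.Unit → ℤ) (f : 𝒢.Arrow → ℤ) : 𝒢.act h (-f) = -𝒢.act h f := by
  funext g
  simp only [act, Pi.neg_apply, mul_neg, finsum_neg_distrib]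

theorem act_zero_left (f : 𝒢.Arrow → ℤ) : 𝒢.act 0 f = 0 := by
  funext g; simp [act]

theorem act_zero_right (h : 𝒢.Unit → ℤ) : 𝒢.act h 0 = 0 := by
  funext g; simp [act]

theorem conv_ind_of_mem {V : Set 𝒢.Arrow} (hV : IsCOB V) (h : 𝒢.Arrow → ℤ) {v g : 𝒢.Arrow}
    (hv : v ∈ V) (e : 𝒢.r v = 𝒢.r g) :
    𝒢.conv (V.indicator 1) h g = h (𝒢.mul (𝒢.inv v) g ((𝒢.s_inv v).trans e)) := by
  unfold conv
  rw [finsum_eq_single _ (⟨v, e⟩ : {a : 𝒢.Arrow // 𝒢.r a = 𝒢.r g})]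
  · simp [hv]
  · rintro ⟨a, ha⟩ hne
    rw [Set.indicator_of_notMem, zero_mul]
    intro haV
    exact hne (Subtype.ext (hV.inj_r haV hv (ha.trans e.symm)))

theorem conv_ind_of_not {V : Set 𝒢.Arrow} (h : 𝒢.Arrow → ℤ) {g : 𝒢.Arrow}
    (hg : ¬ ∃ v ∈ V, 𝒢.r v = 𝒢.r g) : 𝒢.conv (V.indicator 1) h g = 0 := by
  unfold conv
  rw [← finsum_zero (α := {a : 𝒢.Arrow // 𝒢.r a = 𝒢.r g})]
  congr 1; funext a
  rw [Set.indicator_of_notMem, zero_mul]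
  exact fun ha => hg ⟨a, ha, a.2⟩

theorem act_ind_of_mem {V : Set 𝒢.Arrow} (hV : IsCOB V) (h : 𝒢.Unit → ℤ) {v : 𝒢.Arrow}
    {x : 𝒢.Unit} (hv : v ∈ V) (e : 𝒢.s v = x) : 𝒢.act h (V.indicator 1) x = h (𝒢.r v) := by
  unfold act
  rw [finsum_eq_single _ (⟨v, e⟩ : {a : 𝒢.Arrow // 𝒢.s a = x})]
  · simp [hv]
  · rintro ⟨a, ha⟩ hne
    rw [Set.indicator_of_notMem, mul_zero]
    intro haV
    exact hne (Subtype.ext (hV.inj_s haV hv (ha.trans e.symm)))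

theorem act_ind_of_not {V : Set 𝒢.Arrow} (h : 𝒢.Unit → ℤ) {x : 𝒢.Unit}
    (hx : ¬ ∃ v ∈ V, 𝒢.s v = x) : 𝒢.act h (V.indicator 1) x = 0 := by
  unfold act
  rw [← finsum_zero (α := {a : 𝒢.Arrow // 𝒢.s a = x})]
  congr 1; funext a
  rw [Set.indicator_of_notMem, mul_zero]
  exact fun ha => hx ⟨a, ha, a.2⟩

/-- The setwise product of two sets of arrows. -/
def mulSet (V W : Set 𝒢.Arrow) : Set 𝒢.Arrow :=
  {g | ∃ v ∈ V, ∃ w ∈ W, ∃ e : 𝒢.s v = 𝒢.r w, 𝒢.mul v w e = g}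

theorem mem_mulSet_iff {V W : Set 𝒢.Arrow} (hV : IsCOB V) {v g : 𝒢.Arrow} (hv : v ∈ V)
    (e : 𝒢.r v = 𝒢.r g) :
    g ∈ mulSet V W ↔ 𝒢.mul (𝒢.inv v) g ((𝒢.s_inv v).trans e) ∈ W := by
  constructor
  · rintro ⟨v', hv', w, hw, e', rfl⟩
    obtain rfl : v = v' := hV.inj_r hv hv' (e.trans (𝒢.r_mul _ _ _))
    rwa [inv_mul_cancel_left]
  · intro h
    refine ⟨v, hv, _, h, ?_, mul_inv_cancel_left v g _ _⟩
    rw [𝒢.r_mul, 𝒢.r_inv]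

theorem conv_ind_ind {V W : Set 𝒢.Arrow} (hV : IsCOB V) :
    𝒢.conv (V.indicator 1) (W.indicator 1) = (mulSet V W).indicator 1 := by
  classical
  funext g
  by_cases hg : ∃ v ∈ V, 𝒢.r v = 𝒢.r g
  · obtain ⟨v, hv, e⟩ := hg
    rw [conv_ind_of_mem hV _ hv e]
    simp only [Set.indicator_apply, mem_mulSet_iff hV hv e]
    rfl
  · rw [conv_ind_of_not _ hg, Set.indicator_of_notMem]
    rintro ⟨v, hv, w, hw, e, rfl⟩
    exact hg ⟨v, hv, (𝒢.r_mul _ _ _).symm⟩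

theorem IsCOB.mulSet [𝒢.IsAmple] {V W : Set 𝒢.Arrow} (hV : IsCOB V) (hW : IsCOB W) :
    IsCOB (mulSet V W) := by
  refine ⟨?_, ?_, ?_, ?_⟩
  · rw [isOpen_iff_mem_nhds]
    rintro g₀ ⟨v₀, hv₀, w₀, hw₀, e₀, rfl⟩
    set g₀ := 𝒢.mul v₀ w₀ e₀ with hg₀
    have er : 𝒢.r v₀ = 𝒢.r g₀ := (𝒢.r_mul _ _ _).symm
    obtain ⟨e, he, her⟩ := (isLocalHomeomorph_r (𝒢 := 𝒢)) v₀
    obtain ⟨O, hO, hOW⟩ := isOpen_induced_iff.1 (hW.isOpen.preimage 𝒢.continuous_mul)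
    have ht : 𝒢.r g₀ ∈ e.target := by rw [← er, her]; exact e.map_source he
    have hσ : e.symm (𝒢.r g₀) = v₀ := by rw [← er, her]; exact e.left_inv he
    have hc : Filter.Tendsto (fun g => e.symm (𝒢.r g)) (𝓝 g₀) (𝓝 v₀) := by
      have := (e.continuousAt_symm ht).tendsto.comp 𝒢.continuous_r.continuousAt.tendsto
      rwa [hσ] at this
    have h1 : ∀ᶠ g in 𝓝 g₀, e.symm (𝒢.r g) ∈ V := hc (hV.isOpen.mem_nhds hv₀)
    have h2 : ∀ᶠ g in 𝓝 g₀, 𝒢.r g ∈ e.target :=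
      𝒢.continuous_r.continuousAt (e.open_target.mem_nhds ht)
    have hp : (𝒢.inv v₀, g₀) ∈ O := by
      have : (⟨(𝒢.inv v₀, g₀), (𝒢.s_inv v₀).trans er⟩ :
          {p : 𝒢.Arrow × 𝒢.Arrow // 𝒢.s p.1 = 𝒢.r p.2}) ∈ Subtype.val ⁻¹' O := by
        rw [hOW]
        change 𝒢.mul (𝒢.inv v₀) g₀ _ ∈ W
        rwa [inv_mul_cancel_left]
      exact this
    have h3 : ∀ᶠ g in 𝓝 g₀, (𝒢.inv (e.symm (𝒢.r g)), g) ∈ O := by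
      have hc' : Filter.Tendsto (fun g => (𝒢.inv (e.symm (𝒢.r g)), g)) (𝓝 g₀)
          (𝓝 (𝒢.inv v₀, g₀)) :=
        ((𝒢.continuous_inv.continuousAt.tendsto).comp hc).prodMk_nhds Filter.tendsto_id
      exact hc' (hO.mem_nhds hp)
    filter_upwards [h1, h2, h3] with g hg1 hg2 hg3
    have eg : 𝒢.r (e.symm (𝒢.r g)) = 𝒢.r g := by
      exact (congrFun her _).trans (e.right_inv hg2)
    rw [mem_mulSet_iff hV hg1 eg]
    have : (⟨(𝒢.inv (e.symm (𝒢.r g)), g), (𝒢.s_inv _).trans eg⟩ :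
        {p : 𝒢.Arrow × 𝒢.Arrow // 𝒢.s p.1 = 𝒢.r p.2}) ∈ Subtype.val ⁻¹' O := hg3
    rw [hOW] at this
    exact this
  · have hcl : IsClosed {p : 𝒢.Arrow × 𝒢.Arrow | 𝒢.s p.1 = 𝒢.r p.2} :=
      isClosed_eq (𝒢.continuous_s.comp continuous_fst) (𝒢.continuous_r.comp continuous_snd)
    have := (hcl.isClosedEmbedding_subtypeVal.isCompact_preimage
      (hV.isCompact.prod hW.isCompact)).image 𝒢.continuous_mul
    convert this using 1
    ext g
    constructor
    · rintro ⟨v, hv, w, hw, e, rfl⟩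
      exact ⟨⟨(v, w), e⟩, ⟨hv, hw⟩, rfl⟩
    · rintro ⟨⟨⟨v, w⟩, e⟩, ⟨hv, hw⟩, rfl⟩
      exact ⟨v, hv, w, hw, e, rfl⟩
  · rintro _ ⟨v, hv, w, hw, e, rfl⟩ _ ⟨v', hv', w', hw', e', rfl⟩ h
    rw [𝒢.s_mul, 𝒢.s_mul] at h
    obtain rfl := hW.inj_s hw hw' h
    obtain rfl := hV.inj_s hv hv' (e.trans e'.symm)
    rfl
  · rintro _ ⟨v, hv, w, hw, e, rfl⟩ _ ⟨v', hv', w', hw', e', rfl⟩ h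
    rw [𝒢.r_mul, 𝒢.r_mul] at h
    obtain rfl := hV.inj_r hv hv' h
    obtain rfl := hW.inj_r hw hw' (e.symm.trans e')
    rfl

theorem conv_mem [𝒢.IsAmple] {f h : 𝒢.Arrow → ℤ} (hf : f ∈ zFun 𝒢.Arrow)
    (hh : h ∈ zFun 𝒢.Arrow) : 𝒢.conv f h ∈ zFun 𝒢.Arrow := by
  refine mem_zFun_induction (P := fun f => 𝒢.conv f h ∈ zFun 𝒢.Arrow) ?_ ?_ ?_ ?_ hf
  · intro V hV
    refine mem_zFun_induction (P := fun h => 𝒢.conv (V.indicator 1) h ∈ zFun 𝒢.Arrow)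
      ?_ ?_ ?_ ?_ hh
    · intro W hW
      rw [conv_ind_ind hV]
      exact (hV.mulSet hW).mem_zFun
    · rw [conv_zero_right]; exact zero_mem _
    · intro h _ h' _ h1 h2
      rw [conv_add_right hV.mem_zFun]; exact add_mem h1 h2
    · intro h _ h1
      rw [conv_neg_right]; exact neg_mem h1
  · rw [conv_zero_left]; exact zero_mem _
  · intro f hf f' hf' h1 h2
    rw [conv_add_left hf hf']; exact add_mem h1 h2
  · intro f _ h1
    rw [conv_neg_left]; exact neg_mem h1

theorem conv_assoc [𝒢.IsAmple] {f h : 𝒢.Arrow → ℤ} (hf : f ∈ zFun 𝒢.Arrow)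
    (hh : h ∈ zFun 𝒢.Arrow) (k : 𝒢.Arrow → ℤ) :
    𝒢.conv (𝒢.conv f h) k = 𝒢.conv f (𝒢.conv h k) := by
  refine mem_zFun_induction (P := fun f => 𝒢.conv (𝒢.conv f h) k = 𝒢.conv f (𝒢.conv h k))
    ?_ ?_ ?_ ?_ hf
  · intro V hV
    refine mem_zFun_induction (P := fun h => 𝒢.conv (𝒢.conv (V.indicator 1) h) k =
      𝒢.conv (V.indicator 1) (𝒢.conv h k)) ?_ ?_ ?_ ?_ hh
    · intro W hW
      rw [conv_ind_ind hV]
      funext g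
      by_cases hg : ∃ v ∈ V, 𝒢.r v = 𝒢.r g
      · obtain ⟨v, hv, e⟩ := hg
        rw [conv_ind_of_mem hV _ hv e]
        set g' := 𝒢.mul (𝒢.inv v) g ((𝒢.s_inv v).trans e) with hg'
        have hrg' : 𝒢.r g' = 𝒢.s v := (𝒢.r_mul _ _ _).trans (𝒢.r_inv _)
        by_cases hg2 : ∃ w ∈ W, 𝒢.r w = 𝒢.r g'
        · obtain ⟨w, hw, e2⟩ := hg2
          rw [conv_ind_of_mem hW _ hw e2]
          have e3 : 𝒢.s v = 𝒢.r w := (e2.trans hrg').symm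
          rw [conv_ind_of_mem (hV.mulSet hW) k (v := 𝒢.mul v w e3) ⟨v, hv, w, hw, e3, rfl⟩
            ((𝒢.r_mul _ _ _).trans e)]
          congr 1
          set x := 𝒢.mul (𝒢.inv w) g' ((𝒢.s_inv w).trans e2) with hx
          have hrx : 𝒢.s w = 𝒢.r x := ((𝒢.r_mul _ _ _).trans (𝒢.r_inv _)).symm
          have hgx : 𝒢.mul (𝒢.mul v w e3) x ((𝒢.s_mul _ _ _).trans hrx) = g := by
            rw [𝒢.mul_assoc _ _ _ e3 hrx]
            refine (mul_congr rfl (mul_inv_cancel_left w g' _ hrx) _ hrg'.symm).trans ?_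
            exact mul_inv_cancel_left v g _ _
          refine (mul_congr rfl hgx.symm _ ?_).trans (inv_mul_cancel_left _ x _ _)
          rw [𝒢.s_inv, 𝒢.r_mul, 𝒢.r_mul, 𝒢.r_mul]
        · rw [conv_ind_of_not _ hg2, conv_ind_of_not]
          rintro ⟨_, ⟨v', hv', w, hw, e3, rfl⟩, e4⟩
          obtain rfl := hV.inj_r hv hv' (e.trans (e4.symm.trans (𝒢.r_mul _ _ _)))
          exact hg2 ⟨w, hw, e3.symm.trans hrg'.symm⟩
      · rw [conv_ind_of_not _ hg, conv_ind_of_not]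
        rintro ⟨_, ⟨v', hv', w, hw, e3, rfl⟩, e4⟩
        exact hg ⟨v', hv', (𝒢.r_mul _ _ _).symm.trans e4⟩
    · simp only [conv_zero_right, conv_zero_left]
    · intro h hh h' hh' h1 h2
      rw [conv_add_right hV.mem_zFun, conv_add_left (conv_mem hV.mem_zFun hh)
        (conv_mem hV.mem_zFun hh'), conv_add_left hh hh', conv_add_right hV.mem_zFun, h1, h2]
    · intro h _ h1
      rw [conv_neg_right, conv_neg_left, conv_neg_left, conv_neg_right, h1]
  · simp only [conv_zero_left]
  · intro f hf f' hf' h1 h2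
    rw [conv_add_left hf hf', conv_add_left (conv_mem hf hh) (conv_mem hf' hh),
      conv_add_left hf hf', h1, h2]
  · intro f _ h1
    rw [conv_neg_left, conv_neg_left, conv_neg_left, h1]

theorem cob_units [𝒢.IsAmple] [CompactSpace 𝒢.Unit] : IsCOB (Set.range 𝒢.unit) := by
  refine ⟨?_, isCompact_range 𝒢.continuous_unit, ?_, ?_⟩
  · rw [isOpen_iff_mem_nhds]
    rintro _ ⟨x, rfl⟩
    obtain ⟨e, he, hes⟩ := (IsAmple.isLocalHomeomorph_s (𝒢 := 𝒢)) (𝒢.unit x)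
    have h1 : ∀ᶠ g in 𝓝 (𝒢.unit x), g ∈ e.source := e.open_source.mem_nhds he
    have h2 : ∀ᶠ g in 𝓝 (𝒢.unit x), 𝒢.unit (𝒢.s g) ∈ e.source := by
      refine (𝒢.continuous_unit.comp 𝒢.continuous_s).continuousAt (e.open_source.mem_nhds ?_)
      simpa [𝒢.s_unit] using he
    filter_upwards [h1, h2] with g hg1 hg2
    refine ⟨𝒢.s g, e.injOn hg2 hg1 ?_⟩
    rw [← hes, 𝒢.s_unit]
  · rintro _ ⟨x, rfl⟩ _ ⟨y, rfl⟩ h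
    rw [𝒢.s_unit, 𝒢.s_unit] at h; rw [h]
  · rintro _ ⟨x, rfl⟩ _ ⟨y, rfl⟩ h
    rw [𝒢.r_unit, 𝒢.r_unit] at h; rw [h]

theorem one_conv [𝒢.IsAmple] [CompactSpace 𝒢.Unit] (h : 𝒢.Arrow → ℤ) :
    𝒢.conv ((Set.range 𝒢.unit).indicator 1) h = h := by
  funext g
  rw [conv_ind_of_mem cob_units h ⟨𝒢.r g, rfl⟩ (𝒢.r_unit _)]
  congr 1
  have h1 : 𝒢.inv (𝒢.unit (𝒢.r g)) = 𝒢.unit (𝒢.r g) := by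
    have := inv_mul_cancel_left (𝒢.unit (𝒢.r g)) (𝒢.unit (𝒢.r g))
      (by rw [𝒢.s_unit, 𝒢.r_unit]) (by rw [𝒢.s_inv, 𝒢.r_mul])
    refine Eq.trans ?_ this
    refine Eq.trans (𝒢.mul_unit _).symm (mul_congr rfl ?_ _ _)
    refine Eq.trans ?_ (Eq.trans (𝒢.unit_mul (𝒢.unit (𝒢.r g))).symm (mul_congr ?_ rfl _ _))
    · rw [𝒢.s_inv, 𝒢.r_unit]
    · rw [𝒢.r_unit]
  exact (mul_congr h1 rfl _ (𝒢.s_unit _)).trans (𝒢.unit_mul g)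

theorem conv_one [𝒢.IsAmple] [CompactSpace 𝒢.Unit] {f : 𝒢.Arrow → ℤ} (hf : f ∈ zFun 𝒢.Arrow) :
    𝒢.conv f ((Set.range 𝒢.unit).indicator 1) = f := by
  refine mem_zFun_induction (P := fun f => 𝒢.conv f ((Set.range 𝒢.unit).indicator 1) = f)
    ?_ ?_ ?_ ?_ hf
  · intro V hV
    rw [conv_ind_ind hV]
    congr 1
    ext g
    constructor
    · rintro ⟨v, hv, _, ⟨x, rfl⟩, e, rfl⟩
      have hx : x = 𝒢.s v := (𝒢.r_unit x).symm.trans e.symm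
      subst hx
      rwa [𝒢.mul_unit]
    · intro hg
      exact ⟨g, hg, _, ⟨𝒢.s g, rfl⟩, (𝒢.r_unit _).symm, 𝒢.mul_unit g⟩
  · exact conv_zero_left _
  · intro f hf f' hf' h1 h2
    rw [conv_add_left hf hf', h1, h2]
  · intro f _ h1
    rw [conv_neg_left, h1]

theorem act_mem [𝒢.IsAmple] {h : 𝒢.Unit → ℤ} {f : 𝒢.Arrow → ℤ} (hh : h ∈ zFun 𝒢.Unit)
    (hf : f ∈ zFun 𝒢.Arrow) : 𝒢.act h f ∈ zFun 𝒢.Unit := by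
  classical
  refine mem_zFun_induction (P := fun f => 𝒢.act h f ∈ zFun 𝒢.Unit) ?_ ?_ ?_ ?_ hf
  · intro V hV
    refine AddSubgroup.closure_induction (p := fun h _ => 𝒢.act h (V.indicator 1) ∈ zFun 𝒢.Unit)
      ?_ ?_ ?_ ?_ hh
    · rintro _ ⟨U, hU, hUc, _, rfl⟩
      refine AddSubgroup.subset_closure ⟨𝒢.s '' (V ∩ 𝒢.r ⁻¹' U),
        (IsAmple.isLocalHomeomorph_s (𝒢 := 𝒢)).isOpenMap _
          (hV.isOpen.inter (hU.preimage 𝒢.continuous_r)),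
        (hV.isCompact.inter_right (hUc.isClosed.preimage 𝒢.continuous_r)).image 𝒢.continuous_s,
        inferInstance, ?_⟩
      funext x
      by_cases hx : ∃ v ∈ V, 𝒢.s v = x
      · obtain ⟨v, hv, rfl⟩ := hx
        rw [act_ind_of_mem hV _ hv rfl]
        have : 𝒢.s v ∈ 𝒢.s '' (V ∩ 𝒢.r ⁻¹' U) ↔ 𝒢.r v ∈ U := by
          constructor
          · rintro ⟨v', ⟨hv', hU'⟩, e⟩
            rwa [hV.inj_s hv hv' e.symm]
          · exact fun h => ⟨v, ⟨hv, h⟩, rfl⟩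
        simp only [Set.indicator_apply, this]
        rfl
      · rw [act_ind_of_not _ hx, Set.indicator_of_notMem]
        rintro ⟨v, ⟨hv, _⟩, e⟩
        exact hx ⟨v, hv, e⟩
    · rw [act_zero_left]; exact zero_mem _
    · intro h h' _ _ h1 h2
      rw [act_add_left hV.mem_zFun]; exact add_mem h1 h2
    · intro h _ h1
      rw [act_neg_left]; exact neg_mem h1
  · rw [act_zero_right]; exact zero_mem _
  · intro f hf f' hf' h1 h2
    rw [act_add_right hf hf']; exact add_mem h1 h2
  · intro f _ h1
    rw [act_neg_right]; exact neg_mem h1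

theorem act_conv [𝒢.IsAmple] (h : 𝒢.Unit → ℤ) {f k : 𝒢.Arrow → ℤ} (hf : f ∈ zFun 𝒢.Arrow)
    (hk : k ∈ zFun 𝒢.Arrow) : 𝒢.act h (𝒢.conv f k) = 𝒢.act (𝒢.act h f) k := by
  refine mem_zFun_induction (P := fun f => 𝒢.act h (𝒢.conv f k) = 𝒢.act (𝒢.act h f) k)
    ?_ ?_ ?_ ?_ hf
  · intro V hV
    refine mem_zFun_induction (P := fun k => 𝒢.act h (𝒢.conv (V.indicator 1) k) =
      𝒢.act (𝒢.act h (V.indicator 1)) k) ?_ ?_ ?_ ?_ hk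
    · intro W hW
      rw [conv_ind_ind hV]
      funext x
      by_cases hx : ∃ w ∈ W, 𝒢.s w = x
      · obtain ⟨w, hw, rfl⟩ := hx
        rw [act_ind_of_mem hW _ hw rfl]
        by_cases hv : ∃ v ∈ V, 𝒢.s v = 𝒢.r w
        · obtain ⟨v, hv, e⟩ := hv
          rw [act_ind_of_mem hV _ hv e, act_ind_of_mem (hV.mulSet hW) h (v := 𝒢.mul v w e)
            ⟨v, hv, w, hw, e, rfl⟩ (𝒢.s_mul _ _ _), 𝒢.r_mul]
        · rw [act_ind_of_not _ hv, act_ind_of_not]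
          rintro ⟨_, ⟨v, hv', w', hw', e, rfl⟩, e2⟩
          obtain rfl := hW.inj_s hw hw' (e2.symm.trans (𝒢.s_mul _ _ _))
          exact hv ⟨v, hv', e⟩
      · rw [act_ind_of_not _ hx, act_ind_of_not]
        rintro ⟨_, ⟨v, hv', w', hw', e, rfl⟩, e2⟩
        exact hx ⟨w', hw', (𝒢.s_mul _ _ _).symm.trans e2⟩
    · simp only [conv_zero_right, act_zero_right]
    · intro k hk k' hk' h1 h2
      rw [conv_add_right hV.mem_zFun, act_add_right (conv_mem hV.mem_zFun hk)
        (conv_mem hV.mem_zFun hk'), act_add_right hk hk', h1, h2]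
    · intro k _ h1
      rw [conv_neg_right, act_neg_right, act_neg_right, h1]
  · simp only [conv_zero_left, act_zero_right, act_zero_left]
  · intro f hf f' hf' h1 h2
    rw [conv_add_left hf hf', act_add_right (conv_mem hf hk) (conv_mem hf' hk),
      act_add_right hf hf', act_add_left hk, h1, h2]
  · intro f _ h1
    rw [conv_neg_left, act_neg_right, act_neg_right, act_neg_left, h1]

theorem act_one [𝒢.IsAmple] [CompactSpace 𝒢.Unit] (h : 𝒢.Unit → ℤ) :
    𝒢.act h ((Set.range 𝒢.unit).indicator 1) = h := by
  funext x
  rw [act_ind_of_mem cob_units h ⟨x, rfl⟩ (𝒢.s_unit x), 𝒢.r_unit]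

end Aux

variable (𝒢)

/-- The additive group underlying the groupoid ring `ℤ𝒢`. -/
def Alg : Type u := zFun 𝒢.Arrow

/-- The additive group `ℤ𝒢⁰`. -/
def Triv : Type u := zFun 𝒢.Unit

noncomputable instance : AddCommGroup 𝒢.Alg := inferInstanceAs (AddCommGroup (zFun 𝒢.Arrow))

noncomputable instance : AddCommGroup 𝒢.Triv := inferInstanceAs (AddCommGroup (zFun 𝒢.Unit))

variable [𝒢.IsAmple]

/-- The convolution ring `ℤ𝒢` of an ample groupoid. -/
noncomputable instance : NonUnitalRing 𝒢.Alg where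
  __ := (inferInstance : AddCommGroup 𝒢.Alg)
  mul f h := ⟨𝒢.conv f.1 h.1, conv_mem f.2 h.2⟩
  left_distrib f h k := Subtype.ext (conv_add_right f.2 h.1 k.1)
  right_distrib f h k := Subtype.ext (conv_add_left f.2 h.2 k.1)
  zero_mul f := Subtype.ext (conv_zero_left f.1)
  mul_zero f := Subtype.ext (conv_zero_right f.1)
  mul_assoc f h k := Subtype.ext (conv_assoc f.2 h.2 k.1)

/-- If the unit space is compact, then `ℤ𝒢` is unital, with identity the characteristic function
of the set of units, and the unitary modules are the modules on which the identity acts as the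
identity map. -/
noncomputable instance [CompactSpace 𝒢.Unit] : Ring 𝒢.Alg where
  __ := (inferInstance : NonUnitalRing 𝒢.Alg)
  one := ⟨(Set.range 𝒢.unit).indicator 1, cob_units.mem_zFun⟩
  one_mul f := Subtype.ext (one_conv f.1)
  mul_one f := Subtype.ext (conv_one f.2)

/-- The trivial right `ℤ𝒢`-module `ℤ𝒢⁰`. -/
noncomputable instance [CompactSpace 𝒢.Unit] : Module 𝒢.Algᵐᵒᵖ 𝒢.Triv where
  smul f h := ⟨𝒢.act h.1 f.unop.1, act_mem h.2 f.unop.2⟩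
  one_smul h := Subtype.ext (act_one h.1)
  mul_smul f k h := Subtype.ext (act_conv h.1 k.unop.2 f.unop.2)
  smul_zero f := Subtype.ext (act_zero_left f.unop.1)
  smul_add f h k := Subtype.ext (act_add_left f.unop.2 h.1 k.1)
  add_smul f k h := Subtype.ext (act_add_right f.unop.2 k.unop.2 h.1)
  zero_smul h := Subtype.ext (act_zero_right h.1)

instance [CompactSpace 𝒢.Arrow] : CompactSpace 𝒢.Unit where
  isCompact_univ := by
    have h : Set.range 𝒢.s = Set.univ :=
      Set.range_eq_univ.2 fun x => ⟨𝒢.unit x, 𝒢.s_unit x⟩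
    rw [← h]
    exact isCompact_range 𝒢.continuous_s

end TopGroupoid

section Tor

open scoped TensorProduct

variable (A : Type u) [Ring A] (N : Type u) [AddCommGroup N] [Module Aᵐᵒᵖ N]

/-- The relations `na ⊗ m = n ⊗ am`. -/
def balancedRel (M : Type w) [AddCommGroup M] [Module A M] : AddSubgroup (N ⊗[ℤ] M) :=
  AddSubgroup.closure
    {z | ∃ (n : N) (a : A) (m : M), z = (MulOpposite.op a • n) ⊗ₜ[ℤ] m - n ⊗ₜ[ℤ] (a • m)}

/-- The tensor product `N ⊗_A M` of a right and a left module over a ring `A`. -/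
abbrev BalancedTensor (M : Type w) [AddCommGroup M] [Module A M] : Type (max u w) :=
  (N ⊗[ℤ] M) ⧸ balancedRel A N M

/-- The map `N ⊗_A M → N ⊗_A M'` induced by a linear map `M → M'`. -/
noncomputable def balancedMap {M M' : Type w} [AddCommGroup M] [Module A M] [AddCommGroup M']
    [Module A M'] (f : M →ₗ[A] M') : BalancedTensor A N M →+ BalancedTensor A N M' :=
  QuotientAddGroup.map _ _ (LinearMap.lTensor N f.toAddMonoidHom.toIntLinearMap).toAddMonoidHom (by
    rw [balancedRel, AddSubgroup.closure_le]
    rintro _ ⟨n, a, m, rfl⟩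
    refine AddSubgroup.subset_closure ⟨n, a, f m, ?_⟩
    rw [map_sub]
    exact congrArg₂ _ rfl (congrArg (fun y => n ⊗ₜ[ℤ] y) (f.map_smul a m)))

theorem balancedTensor_hom_ext {M : Type w} [AddCommGroup M] [Module A M] {B : Type*}
    [AddCommGroup B] {φ ψ : BalancedTensor A N M →+ B}
    (h : ∀ (n : N) (m : M), φ (QuotientAddGroup.mk (n ⊗ₜ[ℤ] m)) =
      ψ (QuotientAddGroup.mk (n ⊗ₜ[ℤ] m))) : φ = ψ := by
  refine QuotientAddGroup.addMonoidHom_ext _ (AddMonoidHom.ext fun z => ?_)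
  induction z using TensorProduct.induction_on with
  | zero => rw [map_zero, map_zero]
  | tmul n m => exact h n m
  | add x y hx hy => rw [map_add, map_add, hx, hy]

/-- The functor `N ⊗_A -` from left `A`-modules to abelian groups. -/
noncomputable def tensorFunctor : ModuleCat.{max u w} A ⥤ AddCommGrpCat.{max u w} where
  obj M := AddCommGrpCat.of (BalancedTensor A N M)
  map f := AddCommGrpCat.ofHom (balancedMap A N f.hom)
  map_id _ := AddCommGrpCat.hom_ext (balancedTensor_hom_ext A N fun _ _ => rfl)
  map_comp _ _ := AddCommGrpCat.hom_ext (balancedTensor_hom_ext A N fun _ _ => rfl)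

instance : (tensorFunctor.{u, w} A N).Additive where
  map_add {_ M'} f g := AddCommGrpCat.hom_ext (balancedTensor_hom_ext A N fun n m =>
    congrArg (QuotientAddGroup.mk (s := balancedRel A N M'))
      (TensorProduct.tmul_add n (f.hom m) (g.hom m)))

/-- `Tor_n^A(N, -)`, the left derived functors of `N ⊗_A -`. -/
noncomputable def torFunctor (n : ℕ) : ModuleCat.{max u w} A ⥤ AddCommGrpCat.{max u w} :=
  (tensorFunctor.{u, w} A N).leftDerived n

end Tor

namespace TopGroupoid

variable (𝒢 : TopGroupoid.{u}) [𝒢.IsAmple] [CompactSpace 𝒢.Unit]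

/-- The homology `H_n(𝒢, M) = Tor_n^{ℤ𝒢}(ℤ𝒢⁰, M)` of an ample groupoid with compact unit space
with coefficients in a unitary left `ℤ𝒢`-module. -/
noncomputable def homology (n : ℕ) (M : ModuleCat.{max u w} 𝒢.Alg) : AddCommGrpCat.{max u w} :=
  (torFunctor.{u, w} 𝒢.Alg 𝒢.Triv n).obj M

/-- The homological dimension `sup {n | H_n(𝒢, -) ≠ 0}`, a natural number or infinity. -/
noncomputable def homologicalDimension : ℕ∞ :=
  sSup {d | ∃ n : ℕ, d = n ∧ ∃ M : ModuleCat.{max u w} 𝒢.Alg,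
    Nontrivial (homology.{u, w} 𝒢 n M)}

end TopGroupoid

/-! Everything comes from one clopen set `Y` of units that meets each orbit in exactly one point.
Since the groupoid is principal, `g ↦ (r g, s g)` is injective; being continuous from a compact
space to a Hausdorff one, it is a closed embedding. The units are open among the arrows, so close to
a diagonal point `(x, x)` there are no arrows but units: every `x` has a clopen neighbourhood that
meets each orbit at most once. Finitely many of these cover the unit space, and they are glued into
`Y` by discarding from each new piece the orbits already met (`exists_clopen_transversal`).

The orbit relation is the closed image of the embedding and the orbit map is open, so the orbit
space is Hausdorff. The orbit map restricts to a continuous bijection from the compact set `Y`,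
hence to a homeomorphism, whose inverse is the section.

For the homology, each unit `x` is the source of exactly one arrow with range in `Y`. Hence `φ(h)(g)
= 1_Y(r g) h(s g)` is a map of right modules `ℤ𝒢⁰ → ℤ𝒢`, and acting on the constant function `1` is
a left inverse: `1 · φ(h) = h`. Thus `ℤ𝒢⁰` is a direct summand of the ring, and its higher `Tor`
vanishes. -/

namespace TopGroupoid

/-! ### Clopen transversals of the orbits. -/

section Transversal

variable {𝒢 : TopGroupoid.{u}}

/-- The union of all orbits that meet `U`. -/
def saturation (U : Set 𝒢.Unit) : Set 𝒢.Unit := 𝒢.r '' (𝒢.s ⁻¹' U)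

theorem subset_saturation (U : Set 𝒢.Unit) : U ⊆ saturation U :=
  fun x hx => ⟨𝒢.unit x, by rwa [Set.mem_preimage, 𝒢.s_unit], 𝒢.r_unit x⟩

theorem saturation_mono {U V : Set 𝒢.Unit} (h : U ⊆ V) : saturation U ⊆ saturation V :=
  Set.image_mono (Set.preimage_mono h)

theorem s_mem_saturation {U : Set 𝒢.Unit} {g : 𝒢.Arrow} (hg : 𝒢.r g ∈ U) :
    𝒢.s g ∈ saturation U :=
  ⟨𝒢.inv g, by rwa [Set.mem_preimage, 𝒢.s_inv], 𝒢.r_inv g⟩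

/-- Closedness comes from compactness of the arrow space, openness from `r` being a local
homeomorphism. -/
theorem isClopen_saturation [𝒢.IsAmple] [CompactSpace 𝒢.Arrow] {U : Set 𝒢.Unit}
    (hU : IsClopen U) : IsClopen (saturation U) :=
  ⟨((hU.1.preimage 𝒢.continuous_s).isCompact.image 𝒢.continuous_r).isClosed,
    isLocalHomeomorph_r.isOpenMap _ (hU.2.preimage 𝒢.continuous_s)⟩

/-- Every arrow between two points of `Y` is a unit. -/
def IsTransverse (Y : Set 𝒢.Unit) : Prop :=
  ∀ g : 𝒢.Arrow, 𝒢.r g ∈ Y → 𝒢.s g ∈ Y → g = 𝒢.unit (𝒢.s g)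

theorem IsPrincipal.injective_prodMk (h𝒢 : 𝒢.IsPrincipal) :
    Function.Injective fun g : 𝒢.Arrow => (𝒢.r g, 𝒢.s g) := by
  intro g h hgh
  obtain ⟨hr, hs⟩ := Prod.ext_iff.1 hgh
  have e : 𝒢.s (𝒢.inv g) = 𝒢.r h := (𝒢.s_inv g).trans hr
  -- If `g` and `h` have the same ends, then `g⁻¹h` is an isotropy element, hence a unit.
  have h1 := h𝒢 (𝒢.mul (𝒢.inv g) h e) (by
    rw [𝒢.s_mul, 𝒢.r_mul, 𝒢.r_inv]; exact hs.symm)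
  have h2 := mul_inv_cancel_left g h e (by rw [𝒢.r_mul, 𝒢.r_inv])
  rw [← h2]
  refine (𝒢.mul_unit g).symm.trans (mul_congr rfl ?_ _ _)
  rw [h1, 𝒢.s_mul]
  exact congrArg _ hs

theorem IsPrincipal.isClosedEmbedding_prodMk [𝒢.IsAmple] [CompactSpace 𝒢.Arrow]
    (h𝒢 : 𝒢.IsPrincipal) : IsClosedEmbedding fun g : 𝒢.Arrow => (𝒢.r g, 𝒢.s g) :=
  (𝒢.continuous_r.prodMk 𝒢.continuous_s).isClosedEmbedding h𝒢.injective_prodMk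

/-- As `(r, s)` is an embedding, the open set of units is the preimage of an open set `O` of pairs.
Any square inside `O` around `(x, x)` then receives only units. -/
theorem IsPrincipal.exists_isTransverse_nhds [𝒢.IsAmple] [CompactSpace 𝒢.Arrow]
    (h𝒢 : 𝒢.IsPrincipal) (x : 𝒢.Unit) : ∃ U, IsClopen U ∧ x ∈ U ∧ IsTransverse U := by
  obtain ⟨O, hO, hO'⟩ := h𝒢.isClosedEmbedding_prodMk.isInducing.isOpen_iff.1
    (cob_units (𝒢 := 𝒢)).isOpen
  have hx : (x, x) ∈ O := by
    have : 𝒢.unit x ∈ (fun g : 𝒢.Arrow => (𝒢.r g, 𝒢.s g)) ⁻¹' O := by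
      rw [hO']; exact ⟨x, rfl⟩
    simpa [𝒢.r_unit, 𝒢.s_unit] using this
  obtain ⟨A, B, hA, hB, hxA, hxB, hAB⟩ := isOpen_prod_iff.1 hO x x hx
  obtain ⟨C, hC, hCc, hxC, hCAB⟩ := exists_compact_open (hA.inter hB) ⟨hxA, hxB⟩
  refine ⟨C, ⟨hCc.isClosed, hC⟩, hxC, fun g hr hs => ?_⟩
  have : g ∈ (fun g : 𝒢.Arrow => (𝒢.r g, 𝒢.s g)) ⁻¹' O :=
    hAB ⟨(hCAB hr).1, (hCAB hs).2⟩
  rw [hO'] at this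
  obtain ⟨y, rfl⟩ := this
  rw [𝒢.s_unit]

/-- A greedy choice: a new piece contributes only those of its points whose orbits are not yet met.
Clopen saturations keep the result clopen. -/
theorem exists_isTransverse_of_finset [𝒢.IsAmple] [CompactSpace 𝒢.Arrow]
    (T : Finset (Set 𝒢.Unit)) (hT : ∀ U ∈ T, IsClopen U ∧ IsTransverse U) :
    ∃ Y, IsClopen Y ∧ IsTransverse Y ∧ ∀ U ∈ T, U ⊆ saturation Y := by
  classical
  induction T using Finset.induction_on with
  | empty => exact ⟨∅, isClopen_empty, fun _ h => h.elim, by simp⟩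
  | insert V T _ ih =>
    obtain ⟨Y, hY, hYt, hYT⟩ := ih fun U hU => hT U (Finset.mem_insert_of_mem hU)
    obtain ⟨hV, hVt⟩ := hT V (Finset.mem_insert_self _ _)
    refine ⟨Y ∪ V \ saturation Y, hY.union (hV.diff (isClopen_saturation hY)), ?_, ?_⟩
    -- An arrow between the old part and the new part would put a point of the new part into
    -- `saturation Y`, so only the two unmixed cases survive.
    · rintro g (hr | hr) (hs | hs)
      · exact hYt g hr hs
      · exact (hs.2 (s_mem_saturation hr)).elim
      · exact (hr.2 ⟨g, hs, rfl⟩).elim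
      · exact hVt g hr.1 hs.1
    · intro U hU
      rcases Finset.mem_insert.1 hU with rfl | hU
      · intro x hx
        by_cases hxY : x ∈ saturation Y
        · exact saturation_mono Set.subset_union_left hxY
        · exact subset_saturation _ (Or.inr ⟨hx, hxY⟩)
      · exact (hYT U hU).trans (saturation_mono Set.subset_union_left)

theorem IsPrincipal.exists_clopen_transversal [𝒢.IsAmple] [CompactSpace 𝒢.Arrow]
    (h𝒢 : 𝒢.IsPrincipal) : ∃ Y : Set 𝒢.Unit, IsClopen Y ∧ IsTransverse Y ∧ 𝒢.IsFull Y := by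
  classical
  choose B hB hxB hBt using h𝒢.exists_isTransverse_nhds
  obtain ⟨t, ht⟩ := isCompact_univ.elim_finite_subcover B (fun x => (hB x).2)
    fun x _ => Set.mem_iUnion.2 ⟨x, hxB x⟩
  obtain ⟨Y, hY, hYt, hYT⟩ := exists_isTransverse_of_finset (t.image B) (by
    intro U hU
    obtain ⟨x, _, rfl⟩ := Finset.mem_image.1 hU
    exact ⟨hB x, hBt x⟩)
  refine ⟨Y, hY, hYt, Set.eq_univ_of_forall fun y => ?_⟩
  obtain ⟨x, hx, hyx⟩ := Set.mem_iUnion₂.1 (ht (Set.mem_univ y))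
  exact hYT _ (Finset.mem_image_of_mem _ hx) hyx

/-! ### The orbit space and its section. -/

theorem orbitMap_eq_iff {x y : 𝒢.Unit} :
    𝒢.orbitMap x = 𝒢.orbitMap y ↔ ∃ g : 𝒢.Arrow, 𝒢.s g = x ∧ 𝒢.r g = y :=
  Quotient.eq

theorem continuous_orbitMap : Continuous 𝒢.orbitMap := continuous_quotient_mk'

theorem isOpenQuotientMap_orbitMap [𝒢.IsAmple] : IsOpenQuotientMap 𝒢.orbitMap := by
  refine ⟨Quotient.mk_surjective, continuous_orbitMap, fun U hU => ?_⟩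
  -- Openness in the quotient is tested on the preimage, which is a saturation and so the image of
  -- an open set under the open map `r`.
  have h : 𝒢.orbitMap ⁻¹' (𝒢.orbitMap '' U) = saturation U := by
    ext y
    constructor
    · rintro ⟨x, hx, hxy⟩
      obtain ⟨g, rfl, rfl⟩ := orbitMap_eq_iff.1 hxy
      exact ⟨g, hx, rfl⟩
    · rintro ⟨g, hg, rfl⟩
      exact ⟨_, hg, orbitMap_eq_iff.2 ⟨g, rfl, rfl⟩⟩
  rw [← isQuotientMap_quotient_mk'.isOpen_preimage]
  change IsOpen (𝒢.orbitMap ⁻¹' (𝒢.orbitMap '' U))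
  rw [h]
  exact isLocalHomeomorph_r.isOpenMap _ (hU.preimage 𝒢.continuous_s)

/-- For an open quotient map, the quotient is Hausdorff exactly when the relation is closed; here
the relation is the range of the closed embedding `(r, s)`. -/
theorem IsPrincipal.t2Space_orbitSpace [𝒢.IsAmple] [CompactSpace 𝒢.Arrow]
    (h𝒢 : 𝒢.IsPrincipal) : T2Space 𝒢.OrbitSpace := by
  rw [t2Space_iff_of_isOpenQuotientMap isOpenQuotientMap_orbitMap]
  convert h𝒢.isClosedEmbedding_prodMk.isClosed_range using 1
  ext ⟨x, y⟩
  change 𝒢.orbitMap x = 𝒢.orbitMap y ↔ _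
  -- The pair lists the range first, whereas the orbit relation lists the source first.
  rw [eq_comm, orbitMap_eq_iff]
  constructor
  · rintro ⟨g, rfl, rfl⟩; exact ⟨g, rfl⟩
  · rintro ⟨g, hg⟩
    obtain ⟨rfl, rfl⟩ := Prod.ext_iff.1 hg
    exact ⟨g, rfl, rfl⟩

theorem IsTransverse.exists_section [𝒢.IsAmple] [CompactSpace 𝒢.Unit] [T2Space 𝒢.OrbitSpace]
    {Y : Set 𝒢.Unit} (hY : IsClosed Y) (hYt : IsTransverse Y) (hYf : 𝒢.IsFull Y) :
    ∃ t : 𝒢.OrbitSpace → 𝒢.Unit, Continuous t ∧ (∀ x, 𝒢.orbitMap (t x) = x) ∧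
      Set.range t = Y := by
  have : CompactSpace Y := isCompact_iff_compactSpace.1 hY.isCompact
  let q : Y → 𝒢.OrbitSpace := fun y => 𝒢.orbitMap y
  have hq : Function.Bijective q := by
    constructor
    · intro x y hxy
      obtain ⟨g, hs, hr⟩ := orbitMap_eq_iff.1 hxy
      -- Points of `Y` in one orbit are joined by an arrow between points of `Y`; that arrow is a
      -- unit, so they coincide.
      have hg := hYt g (hr ▸ y.2) (hs ▸ x.2)
      apply Subtype.ext
      rw [← hs, ← hr, hg, 𝒢.s_unit, 𝒢.r_unit]
    · intro z
      obtain ⟨x, rfl⟩ := Quotient.mk_surjective z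
      have hx : x ∈ 𝒢.r '' (𝒢.s ⁻¹' Y) := hYf ▸ Set.mem_univ x
      obtain ⟨g, hg, rfl⟩ := hx
      exact ⟨⟨_, hg⟩, orbitMap_eq_iff.2 ⟨g, rfl, rfl⟩⟩
  have hqc : Continuous (Equiv.ofBijective q hq) :=
    continuous_orbitMap.comp continuous_subtype_val
  -- The continuous bijection from compact `Y` to the Hausdorff orbit space is a homeomorphism; its
  -- inverse, followed by the inclusion, is the section.
  let e := hqc.homeoOfEquivCompactToT2
  refine ⟨fun z => e.symm z, continuous_subtype_val.comp e.symm.continuous,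
    fun z => e.apply_symm_apply z, ?_⟩
  change Set.range (Subtype.val ∘ e.symm) = Y
  rw [Set.range_comp, e.symm.surjective.range_eq, Set.image_univ, Subtype.range_coe]

theorem IsTransverse.reduction_eq {Y : Set 𝒢.Unit} (hY : IsTransverse Y) :
    {g | 𝒢.r g ∈ Y ∧ 𝒢.s g ∈ Y} = 𝒢.unit '' Y := by
  ext g
  constructor
  · rintro ⟨hr, hs⟩
    exact ⟨_, hs, (hY g hr hs).symm⟩
  · rintro ⟨y, hy, rfl⟩
    exact ⟨by rwa [𝒢.r_unit], by rwa [𝒢.s_unit]⟩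

end Transversal

end TopGroupoid


/-! ### Vanishing of left derived functors for retracts of exact functors. -/

section LeftDerived

variable {C D : Type*} [Category* C] [Category* D] [Abelian C] [EnoughProjectives C] [Abelian D]

/-- A projective resolution is exact in positive degrees, and stays so after applying `F`. -/
theorem isZero_leftDerived_obj_succ_of_preservesHomology (F : C ⥤ D) [F.Additive]
    [F.PreservesHomology] (X : C) (n : ℕ) : Limits.IsZero ((F.leftDerived (n + 1)).obj X) := by
  let P := ProjectiveResolution.of X
  refine Limits.IsZero.of_iso ?_ (P.isoLeftDerivedObj F (n + 1))
  refine (HomologicalComplex.exactAt_iff_isZero_homology _ _).1 ?_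
  exact ((HomologicalComplex.exactAt_iff _ _).1 (P.complex_exactAt_succ n)).map F

/-- Deriving is functorial in the functor, so the identity of the derived functor of `F` factors
through that of `G`, which vanishes. -/
theorem isZero_leftDerived_obj_succ_of_retract {F G : C ⥤ D} [F.Additive] [G.Additive]
    [G.PreservesHomology] (i : F ⟶ G) (p : G ⟶ F) (h : i ≫ p = 𝟙 F) (X : C) (n : ℕ) :
    Limits.IsZero ((F.leftDerived (n + 1)).obj X) := by
  have h1 := congrArg (fun α => α.app X) (NatTrans.leftDerived_comp i p (n + 1))
  simp only [h, NatTrans.leftDerived_id, NatTrans.comp_app, NatTrans.id_app] at h1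
  rw [Limits.IsZero.iff_id_eq_zero, h1,
    (isZero_leftDerived_obj_succ_of_preservesHomology G X n).eq_of_tgt
      ((NatTrans.leftDerived i (n + 1)).app X) 0, Limits.zero_comp]

end LeftDerived

/-! ### `Tor` of a right module that is a retract of the ring. -/

section Tor

open scoped TensorProduct

variable {A : Type u} [Ring A] {N : Type u} [AddCommGroup N] [Module Aᵐᵒᵖ N]

/-- The map `N ⊗_A M → M`, `n ⊗ m ↦ φ(n)m`, for a homomorphism `φ : N → A` of right modules. -/
noncomputable def balancedLift (φ : N →+ A) (hφ : ∀ n a, φ (MulOpposite.op a • n) = φ n * a)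
    (M : Type w) [AddCommGroup M] [Module A M] : BalancedTensor A N M →+ M :=
  QuotientAddGroup.lift _
    (TensorProduct.liftAddHom ((smulAddHom A M).comp φ) fun r n m => by
      simp only [AddMonoidHom.comp_apply, map_zsmul, AddMonoidHom.zsmul_apply]) (by
    rw [balancedRel, AddSubgroup.closure_le]
    rintro _ ⟨n, a, m, rfl⟩
    simp [hφ, mul_smul])

/-- The map `M → N ⊗_A M`, `m ↦ n ⊗ m`. -/
noncomputable def balancedMk (n : N) (M : Type w) [AddCommGroup M] [Module A M] :
    M →+ BalancedTensor A N M :=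
  (QuotientAddGroup.mk' _).comp (TensorProduct.mk ℤ N M n).toAddMonoidHom

theorem balancedTensor_mk_smul_tmul {M : Type w} [AddCommGroup M] [Module A M] (n : N) (a : A)
    (m : M) : (QuotientAddGroup.mk ((MulOpposite.op a • n) ⊗ₜ[ℤ] m) : BalancedTensor A N M) =
      QuotientAddGroup.mk (n ⊗ₜ[ℤ] (a • m)) :=
  QuotientAddGroup.eq_iff_sub_mem.2 (AddSubgroup.subset_closure ⟨n, a, m, rfl⟩)

/-- `Tor` vanishes for a right module that is a retract of the ring. -/
theorem isZero_torFunctor_obj_succ (φ : N →+ A) (hφ : ∀ n a, φ (MulOpposite.op a • n) = φ n * a)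
    (n₀ : N) (hn₀ : ∀ n, MulOpposite.op (φ n) • n₀ = n) (M : ModuleCat.{max u w} A) (n : ℕ) :
    Limits.IsZero ((torFunctor.{u, w} A N (n + 1)).obj M) := by
  -- The exact functor is the forgetful one, that is, tensoring with `A` itself. The composite `i ≫
  -- p` sends `n ⊗ m` to `n₀ ⊗ φ(n)m = n₀φ(n) ⊗ m = n ⊗ m`.
  let i : tensorFunctor.{u, w} A N ⟶ forget₂ (ModuleCat.{max u w} A) AddCommGrpCat.{max u w} :=
    { app M := AddCommGrpCat.ofHom (balancedLift φ hφ M)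
      naturality _ _ f := AddCommGrpCat.hom_ext (balancedTensor_hom_ext A N fun n m =>
        (f.hom.map_smul (φ n) m).symm) }
  let p : forget₂ (ModuleCat.{max u w} A) AddCommGrpCat.{max u w} ⟶ tensorFunctor.{u, w} A N :=
    { app M := AddCommGrpCat.ofHom (balancedMk n₀ M)
      naturality _ _ _ := rfl }
  refine isZero_leftDerived_obj_succ_of_retract i p ?_ M n
  ext M : 2
  refine AddCommGrpCat.hom_ext (balancedTensor_hom_ext A N fun n m => ?_)
  refine (balancedTensor_mk_smul_tmul n₀ (φ n) m).symm.trans ?_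
  rw [hn₀]
  rfl

end Tor

/-! ### The trivial module as a retract of the groupoid ring. -/

namespace TopGroupoid

variable {𝒢 : TopGroupoid.{u}}

theorem mul_inv_cancel_right (a k : 𝒢.Arrow) (e : 𝒢.s a = 𝒢.r k)
    (e' : 𝒢.s (𝒢.mul a k e) = 𝒢.r (𝒢.inv k)) : 𝒢.mul (𝒢.mul a k e) (𝒢.inv k) e' = a := by
  rw [𝒢.mul_assoc _ _ _ e (𝒢.r_inv k).symm]
  refine (mul_congr rfl ((𝒢.mul_inv k).trans (congrArg _ e.symm)) _ (𝒢.r_unit _).symm).trans ?_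
  exact 𝒢.mul_unit a

theorem inv_mul_cancel_right (a k : 𝒢.Arrow) (e : 𝒢.s a = 𝒢.r (𝒢.inv k))
    (e' : 𝒢.s (𝒢.mul a (𝒢.inv k) e) = 𝒢.r k) : 𝒢.mul (𝒢.mul a (𝒢.inv k) e) k e' = a :=
  (mul_congr rfl (inv_inv k).symm _ (by rw [inv_inv, e'])).trans
    (mul_inv_cancel_right a (𝒢.inv k) e (by rw [inv_inv, e']))

theorem mul_right_cancel {a b k : 𝒢.Arrow} (ea : 𝒢.s a = 𝒢.r k) (eb : 𝒢.s b = 𝒢.r k)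
    (h : 𝒢.mul a k ea = 𝒢.mul b k eb) : a = b := by
  rw [← mul_inv_cancel_right a k ea (by rw [𝒢.s_mul, 𝒢.r_inv]),
    ← mul_inv_cancel_right b k eb (by rw [𝒢.s_mul, 𝒢.r_inv])]
  exact mul_congr h rfl _ _

/-- The function `g ↦ 1_Y(r(g)) h(s(g))`. -/
noncomputable def coinduce (Y : Set 𝒢.Unit) (h : 𝒢.Unit → ℤ) (g : 𝒢.Arrow) : ℤ :=
  Y.indicator 1 (𝒢.r g) * h (𝒢.s g)

theorem coinduce_add (Y : Set 𝒢.Unit) (h k : 𝒢.Unit → ℤ) :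
    coinduce Y (h + k) = coinduce Y h + coinduce Y k :=
  funext fun _ => mul_add _ _ _

theorem coinduce_mem [𝒢.IsAmple] [CompactSpace 𝒢.Arrow] [T2Space 𝒢.Arrow] {Y : Set 𝒢.Unit}
    (hY : IsClopen Y) {h : 𝒢.Unit → ℤ} (hh : h ∈ zFun 𝒢.Unit) :
    coinduce Y h ∈ zFun 𝒢.Arrow := by
  classical
  refine AddSubgroup.closure_induction (p := fun h _ => coinduce Y h ∈ zFun 𝒢.Arrow)
    ?_ ?_ ?_ ?_ hh
  · rintro _ ⟨U, hU, hUc, _, rfl⟩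
    -- For the characteristic function of `U` the coinduced function is that of this set, which is
    -- compact because the arrow space is.
    have hc : IsClopen (𝒢.r ⁻¹' Y ∩ 𝒢.s ⁻¹' U) :=
      (hY.preimage 𝒢.continuous_r).inter
        (IsClopen.preimage ⟨hUc.isClosed, hU⟩ 𝒢.continuous_s)
    refine AddSubgroup.subset_closure ⟨_, hc.2, hc.1.isCompact, inferInstance, ?_⟩
    funext g
    by_cases h1 : 𝒢.r g ∈ Y <;> by_cases h2 : 𝒢.s g ∈ U <;> simp [coinduce, h1, h2]
  · rw [show coinduce Y 0 = 0 from funext fun _ => mul_zero _]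
    exact zero_mem _
  · intro h k _ _ h1 h2
    rw [coinduce_add]
    exact add_mem h1 h2
  · intro h _ h1
    rw [show coinduce Y (-h) = -coinduce Y h from funext fun _ => mul_neg _ _]
    exact neg_mem h1

/-- This is right linearity of `φ`. Both sides vanish unless `r g ∈ Y`; then the substitution `b =
a⁻¹g` turns the convolution sum over `r a = r g` into the action sum over `s b = s g`, with `r b = s
a`. -/
theorem coinduce_act (Y : Set 𝒢.Unit) (h : 𝒢.Unit → ℤ) (f : 𝒢.Arrow → ℤ) :
    coinduce Y (𝒢.act h f) = 𝒢.conv (coinduce Y h) f := by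
  funext g
  by_cases hg : 𝒢.r g ∈ Y
  · have h1 : coinduce Y (𝒢.act h f) g = 𝒢.act h f (𝒢.s g) := by simp [coinduce, hg]
    rw [h1, act, conv]
    symm
    refine finsum_eq_of_bijective
      (fun a => ⟨𝒢.mul (𝒢.inv a.1) g ((𝒢.s_inv a.1).trans a.2), 𝒢.s_mul _ _ _⟩) ⟨?_, ?_⟩ ?_
    · rintro ⟨a, ha⟩ ⟨b, hb⟩ hab
      have hab' := mul_right_cancel _ _ (congrArg Subtype.val hab)
      exact Subtype.ext ((inv_inv a).symm.trans ((congrArg 𝒢.inv hab').trans (inv_inv b)))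
    · rintro ⟨b, hb⟩
      -- The preimage of `b` under `a ↦ a⁻¹g` is `gb⁻¹`.
      have e : 𝒢.s g = 𝒢.r (𝒢.inv b) := hb.symm.trans (𝒢.r_inv b).symm
      refine ⟨⟨𝒢.mul g (𝒢.inv b) e, 𝒢.r_mul _ _ _⟩, Subtype.ext ?_⟩
      have e' : 𝒢.s (𝒢.mul g (𝒢.inv b) e) = 𝒢.r b := by rw [𝒢.s_mul, 𝒢.s_inv]
      refine (mul_congr rfl (inv_mul_cancel_right g b e e').symm _ ?_).trans
        (inv_mul_cancel_left _ b e' ?_) <;> simp only [𝒢.s_inv, 𝒢.r_mul]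
    · rintro ⟨a, ha⟩
      have h2 : coinduce Y h a = h (𝒢.s a) := by simp [coinduce, ha, hg]
      dsimp only
      rw [h2, 𝒢.r_mul, 𝒢.r_inv]
  · have h1 : ∀ k, ∀ a, 𝒢.r a = 𝒢.r g → coinduce Y k a = 0 := fun k a ha => by
      simp [coinduce, ha, hg]
    rw [h1 _ g rfl, conv, ← finsum_zero (α := {a : 𝒢.Arrow // 𝒢.r a = 𝒢.r g})]
    congr 1
    funext a
    rw [h1 _ _ a.2, zero_mul]

/-- The sum at `x` runs over the arrows from `x` into `Y`: fullness provides one, transversality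
allows no other, and its term is `h(x)`. -/
theorem act_coinduce {Y : Set 𝒢.Unit} (hYt : IsTransverse Y) (hYf : 𝒢.IsFull Y)
    (h : 𝒢.Unit → ℤ) : 𝒢.act 1 (coinduce Y h) = h := by
  funext x
  obtain ⟨k, hk, rfl⟩ : x ∈ 𝒢.r '' (𝒢.s ⁻¹' Y) := hYf ▸ Set.mem_univ x
  unfold act
  rw [finsum_eq_single _ (⟨𝒢.inv k, 𝒢.s_inv k⟩ : {a : 𝒢.Arrow // 𝒢.s a = 𝒢.r k})]
  · have hk' : 𝒢.s k ∈ Y := hk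
    simp [coinduce, 𝒢.r_inv, 𝒢.s_inv, hk']
  · rintro ⟨a, ha⟩ hne
    -- If `a` also went from `x` into `Y`, then `ak` would have both ends in `Y`, hence be a unit,
    -- equal to `k⁻¹k`; cancelling `k` gives `a = k⁻¹`.
    have : 𝒢.r a ∉ Y := fun hra => hne <| Subtype.ext <| by
      refine mul_right_cancel ha (𝒢.s_inv k) ?_
      rw [hYt (𝒢.mul a k ha) (by rwa [𝒢.r_mul]) (by rwa [𝒢.s_mul]), 𝒢.s_mul, 𝒢.inv_mul]
    simp [coinduce, this]

theorem one_mem_zFun {X : Type u} [TopologicalSpace X] [CompactSpace X] [T2Space X] :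
    (1 : X → ℤ) ∈ zFun X :=
  AddSubgroup.subset_closure
    ⟨Set.univ, isOpen_univ, isCompact_univ, inferInstance, (Set.indicator_univ _).symm⟩

theorem IsTransverse.isZero_homology_succ [𝒢.IsAmple] [CompactSpace 𝒢.Arrow] [T2Space 𝒢.Arrow]
    {Y : Set 𝒢.Unit} (hY : IsClopen Y) (hYt : IsTransverse Y) (hYf : 𝒢.IsFull Y) (n : ℕ)
    (M : ModuleCat.{max u w} 𝒢.Alg) : Limits.IsZero (homology.{u, w} 𝒢 (n + 1) M) :=
  isZero_torFunctor_obj_succ.{u, w} (A := 𝒢.Alg) (N := 𝒢.Triv)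
    (AddMonoidHom.mk' (fun h => ⟨coinduce Y h.1, coinduce_mem hY h.2⟩)
      fun h k => Subtype.ext (coinduce_add Y h.1 k.1))
    (fun h f => Subtype.ext (coinduce_act Y h.1 f.1))
    ⟨1, one_mem_zFun⟩ (fun h => Subtype.ext (act_coinduce hYt hYf h.1)) M n

theorem homologicalDimension_eq_zero [𝒢.IsAmple] [CompactSpace 𝒢.Unit]
    (h : ∀ (n : ℕ) (M : ModuleCat.{max u w} 𝒢.Alg),
      Limits.IsZero (homology.{u, w} 𝒢 (n + 1) M)) : homologicalDimension.{u, w} 𝒢 = 0 := by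
  refine le_antisymm (sSup_le ?_) zero_le
  rintro _ ⟨_ | n, rfl, M, hM⟩
  -- Degree `0` contributes only the value `0` to the supremum, whether or not `H_0` vanishes.
  · exact le_rfl
  · exact (not_subsingleton _ (AddCommGrpCat.subsingleton_of_isZero (h n M))).elim

end TopGroupoid

theorem theoremt (𝒢 : TopGroupoid.{u}) [𝒢.IsAmple] [CompactSpace 𝒢.Arrow] [T2Space 𝒢.Arrow]
    (h𝒢 : 𝒢.IsPrincipal) :
    TopGroupoid.homologicalDimension.{u, w} 𝒢 = 0 ∧
      CompactSpace 𝒢.OrbitSpace ∧ T2Space 𝒢.OrbitSpace ∧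
      TotallyDisconnectedSpace 𝒢.OrbitSpace ∧
      ∃ t : 𝒢.OrbitSpace → 𝒢.Unit, Continuous t ∧ (∀ x, 𝒢.orbitMap (t x) = x) ∧
        IsCompact (Set.range t) ∧ IsOpen (Set.range t) ∧ 𝒢.IsFull (Set.range t) ∧
        {g | 𝒢.r g ∈ Set.range t ∧ 𝒢.s g ∈ Set.range t} = 𝒢.unit '' Set.range t := by
  obtain ⟨Y, hY, hYt, hYf⟩ := h𝒢.exists_clopen_transversal
  have ht2 := h𝒢.t2Space_orbitSpace
  obtain ⟨t, htc, ht, rfl⟩ := hYt.exists_section hY.1 hYf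
  exact ⟨TopGroupoid.homologicalDimension_eq_zero.{u, w} (hYt.isZero_homology_succ hY hYf),
    Quotient.compactSpace, ht2,
    -- The injective map `t` carries a preconnected set of orbits to a preconnected set of units,
    -- which has at most one point.
    ⟨fun _ _ hS _ hx _ hy => Function.LeftInverse.injective ht
      ((hS.image t htc.continuousOn).subsingleton (Set.mem_image_of_mem t hx)
        (Set.mem_image_of_mem t hy))⟩,
    t, htc, ht, hY.1.isCompact, hY.2, hYf, hYt.reduction_eq⟩
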